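/- Let $H\subseteq \mathrm{GF}(4)^5$ be a quaternary Hamming code of length $5$, i.e. the kernel of a $2\times 5$ matrix over $\mathrm{GF}(4)$ whose columns represent each point of the projective line over $\mathrm{GF}(4)$ exactly once, and let $C=\{v : \sum_i v_iw_i^2=0 \text{ for all } w\in H\}$ be its Hermitian dual. Let $C_1\subseteq\mathrm{GF}(2)^3$ be a binary simplex code of dimension $2$, i.e. the Euclidean dual of a binary Hamming code of length $3$. Let $C_1\otimes_2 C\subseteq \mathrm{GF}(4)^{15}$ be their product code, i.e. the $\mathrm{GF}(2)$-span of the arrays $(v_iw_j)_{i,j}$ with $v\in C_1$, $w\in C$. For an additive code $D\subseteq \mathrm{GF}(4)^n$ let $D^\star=\{v:\sum_i \mathrm{tr}(v_iw_i^2)=0\text{ for all } w\in D\}$ be its symplectic dual, where $\mathrm{tr}$ is the trace of $\mathrm{GF}(4)$ over $\mathrm{GF}(2)$; an additive $(n,M,d)$ code over $\mathrm{GF}(4)$ is an additive subgroup of $\mathrm{GF}(4)^n$ with $M$ elements and minimum Hamming distance $d$. Such codes $H$ and $C_1$ exist, and for all of them the following holds. 1. $C$ is a $[5,2,4]_4$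 code contained in its Hermitian dual, which is a $[5,3,3]_4$ code; $C_1$ is a $[3,2,2]_2$ code. 2. $C_1\otimes_2 C$ is an additive $(15,2^8,8)$ code over $\mathrm{GF}(4)$. It is contained in its symplectic dual $(C_1\otimes_2 C)^\star$, which is an additive $(15,2^{22},3)$ code over $\mathrm{GF}(4)$. 3. Fix $\omega\in\mathrm{GF}(4)$ with $\omega^2+\omega+1=0$, and let the word $v=\omega a+\omega^2 b$, with $a,b\in\mathrm{GF}(2)^n$, correspond to the Pauli operator $X^aZ^b$ on $n$ qubits. By a stabilizer code obtained from an additive code $D$ we mean a nonzero joint eigenspace of the operators that correspond to the words of $D$. Stabilizer codes obtained from $C$ and from $C_1\otimes_2 C$ exist. All those obtained from $C$ are $[[5,1,3]]$ binary quantum codes, of rate $1/5$, and all those obtained from $C_1\otimes_2 C$ are $[[15,7,3]]$ binary quantum codes, of larger rate $7/15$. Here an $[[n,k,d]]$ binary quantum code (with $k\ge1$) is a $2^k$-dimensional subspace $Q$ of $(\mathbb C^2)^{\otimes n}$ such that $d$ is the least weight of a Pauli operator $E$ that $Q$ does not detect, where $Q$ detects $E$ if for some scalar $c$ one has $\langle\varphi|E|\psi\rangle=c\langle\varphi|\psi\rangle$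 for all $\varphi,\psi\in Q$; its rate is $k/n$. -/

import Mathlib

open scoped Matrix

/-- The field with four elements. -/
abbrev F4 : Type := GaloisField 2 2

section ClassicalCodes

variable {ι κ : Type*} [Fintype ι] [Fintype κ]

open Classical in
/-- `d` is the minimum Hamming distance between distinct words of the code `D`. -/
def HasMinDist {A : Type*} (D : Set (ι → A)) (d : ℕ) : Prop :=
  IsLeast {t : ℕ | ∃ x ∈ D, ∃ y ∈ D, x ≠ y ∧ hammingDist x y = t} d

/-- `C` is an `[n, k, d]` linear code over the field `F`. -/
def IsLinearCode {F : Type*} [Field F] (C : Submodule F (ι → F)) (n k d : ℕ) : Prop :=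
  Fintype.card ι = n ∧ Module.finrank F C = k ∧ HasMinDist (C : Set (ι → F)) d

/-- `D` is an `(n, M, d)` additive code over `GF(4)`: an additive group of words of length `n`,
with `M` elements and minimum distance `d`. -/
def IsAdditiveCode (D : Submodule (ZMod 2) (ι → F4)) (n M d : ℕ) : Prop :=
  Fintype.card ι = n ∧ Nat.card D = M ∧ HasMinDist (D : Set (ι → F4)) d

/-- The dual code for the Euclidean inner product `∑ i, v i * w i`. -/
def euclideanDual {F : Type*} [Field F] (C : Submodule F (ι → F)) : Submodule F (ι → F) where
  carrier := {v | ∀ w ∈ C, ∑ i, v i * w i = 0}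
  zero_mem' := by simp
  add_mem' := by
    intro a b ha hb w hw
    simp [add_mul, Finset.sum_add_distrib, ha w hw, hb w hw]
  smul_mem' := by
    intro c a ha w hw
    simp [mul_assoc, ← Finset.mul_sum, ha w hw]

/-- The dual code for the Hermitian inner product `∑ i, v i * (w i) ^ 2` over `GF(4)`. -/
noncomputable def hermitianDual (C : Submodule F4 (ι → F4)) : Submodule F4 (ι → F4) where
  carrier := {v | ∀ w ∈ C, ∑ i, v i * w i ^ 2 = 0}
  zero_mem' := by simp
  add_mem' := by
    intro a b ha hb w hw
    simp [add_mul, Finset.sum_add_distrib, ha w hw, hb w hw]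
  smul_mem' := by
    intro c a ha w hw
    simp [mul_assoc, ← Finset.mul_sum, ha w hw]

/-- The dual code for the symplectic (trace) inner product `∑ i, tr (v i * (w i) ^ 2)`, where
`tr` is the trace of `GF(4)` over `GF(2)`. -/
noncomputable def symplecticDual (D : Submodule (ZMod 2) (ι → F4)) :
    Submodule (ZMod 2) (ι → F4) where
  carrier := {v | ∀ w ∈ D, ∑ i, Algebra.trace (ZMod 2) F4 (v i * w i ^ 2) = 0}
  zero_mem' := by simp
  add_mem' := by
    intro a b ha hb w hw
    simp [add_mul, Finset.sum_add_distrib, ha w hw, hb w hw]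
  smul_mem' := by
    intro c a ha w hw
    simp [← Finset.mul_sum, ha w hw]

/-- `C` is a Hamming code of redundancy `r` over `F`: it has a parity check matrix with `r` rows
whose columns represent every point of the projective space of `F ^ r` exactly once. -/
def IsHammingCode {F : Type*} [Field F] (r : ℕ) (C : Submodule F (ι → F)) : Prop :=
  ∃ (H : Matrix (Fin r) ι F) (h0 : ∀ i, H.col i ≠ 0),
    Function.Bijective (fun i => Projectivization.mk F (H.col i) (h0 i)) ∧
      C = LinearMap.ker H.mulVecLin

/-- `S` is a simplex code of dimension `r` over `F`: the Euclidean dual of a Hamming code. -/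
def IsSimplexCode {F : Type*} [Field F] (r : ℕ) (S : Submodule F (ι → F)) : Prop :=
  ∃ C : Submodule F (ι → F), IsHammingCode r C ∧ S = euclideanDual C

/-- The product code `C₁ ⊗ C₂` over `GF(2)` of a binary linear code and an additive code over
`GF(4)`: the `GF(2)`-span of the arrays `(v i * w j)` with `v ∈ C₁`, `w ∈ C₂`. -/
noncomputable def productCode (C₁ : Submodule (ZMod 2) (ι → ZMod 2)) (C₂ : Submodule (ZMod 2) (κ → F4)) :
    Submodule (ZMod 2) (ι × κ → F4) :=
  Submodule.span (ZMod 2) {x | ∃ v ∈ C₁, ∃ w ∈ C₂, x = fun ij => v ij.1 • w ij.2}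

end ClassicalCodes

section QuantumCodes

variable {ι : Type*} [Fintype ι] [DecidableEq ι]

/-- The state vectors of a system of qubits labelled by `ι`: the amplitudes in the computational
basis, which is indexed by bit strings. The scalar product of `φ` and `ψ` is `star φ ⬝ᵥ ψ`. -/
abbrev QState (ι : Type*) : Type _ := (ι → ZMod 2) → ℂ

/-- The Pauli operator `X ^ a Z ^ b`, mapping `|y⟩` to `(-1) ^ (b · y) |y + a⟩`. -/
def pauli (a b : ι → ZMod 2) : Matrix (ι → ZMod 2) (ι → ZMod 2) ℂ :=
  Matrix.of fun x y => if x = y + a then (-1) ^ (b ⬝ᵥ y).val else 0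

/-- The number of qubits on which `pauli a b` acts nontrivially. -/
def pauliWeight (a b : ι → ZMod 2) : ℕ :=
  (Finset.univ.filter fun i => a i ≠ 0 ∨ b i ≠ 0).card

/-- The code space `Q` detects the error `E`: the compression of `E` to `Q` is a scalar. -/
def Detects (Q : Submodule ℂ (QState ι)) (E : Matrix (ι → ZMod 2) (ι → ZMod 2) ℂ) : Prop :=
  ∃ c : ℂ, ∀ φ ∈ Q, ∀ ψ ∈ Q, star φ ⬝ᵥ (E *ᵥ ψ) = c * (star φ ⬝ᵥ ψ)

/-- `Q` is a binary quantum code `[[n, k, d]]`, for `k ≥ 1`: a subspace of dimension `2 ^ k` of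
the state space of `n` qubits, such that `d` is the least weight of an undetectable Pauli error. -/
def IsQECC (Q : Submodule ℂ (QState ι)) (n k d : ℕ) : Prop :=
  Fintype.card ι = n ∧ Module.finrank ℂ Q = 2 ^ k ∧
    IsLeast {t : ℕ | ∃ a b : ι → ZMod 2, pauliWeight a b = t ∧ ¬ Detects Q (pauli a b)} d

/-- The rate `(log₂ dim Q) / n` of a quantum code. -/
noncomputable def quantumRate (Q : Submodule ℂ (QState ι)) : ℝ :=
  Real.logb 2 (Module.finrank ℂ Q) / Fintype.card ι

/-- The Pauli operator of a word `v` over `GF(4)`, for `ω` with `ω ^ 2 + ω + 1 = 0`.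
If `v = ω a + ω ^ 2 b` with binary `a`, `b`, then `a = tr (ω v)`, `b = tr (ω ^ 2 v)`, and the
operator is `X ^ a Z ^ b`. -/
noncomputable def errorOp (ω : F4) (v : ι → F4) : Matrix (ι → ZMod 2) (ι → ZMod 2) ℂ :=
  pauli (fun i => Algebra.trace (ZMod 2) F4 (ω * v i))
    (fun i => Algebra.trace (ZMod 2) F4 (ω ^ 2 * v i))

/-- `Q` is a stabilizer code obtained from the additive code `D`: a nonzero joint eigenspace of
the operators of the words of `D`. -/
def IsStabilizerCodeOf (ω : F4) (D : Submodule (ZMod 2) (ι → F4))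
    (Q : Submodule ℂ (QState ι)) : Prop :=
  Q ≠ ⊥ ∧ ∃ χ : (ι → F4) → ℂ,
    ∀ ψ : QState ι, ψ ∈ Q ↔ ∀ v ∈ D, errorOp ω v *ᵥ ψ = χ v • ψ

end QuantumCodes

/-! Quantum side. The operators E_v of words v multiply up to sign and commute up to the sign given
by the symplectic product, so a self-orthogonal additive code D has a nonzero joint eigenspace Q.
Averaging χ(v)⁻¹ E_v over D gives the projection onto Q; since E_v is traceless for v ≠ 0, its trace
yields dim Q · |D| = 2^n. An error e outside D* anticommutes with some E_w and moves Q to an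
orthogonal space; for e in D it is a scalar on Q; for e in D* but not in D it preserves Q without
being a scalar there. So the undetected errors are exactly D* \ D
(`IsStabilizerCodeOf.detects_iff`), and the quantum distance is that of D* as soon as D itself has
larger distance.

Classical side. A nonzero word of C is, up to conjugation, a linear form evaluated at the five
points of the projective line; it vanishes at exactly one, so its weight is 4. Evenness of the
weights makes C self-orthogonal, with Hermitian dual H. The binary simplex code is the even-weight
code of length 3, so product words are triples of rows in C with sum zero: there are |C|² = 2^8 of
them, and nonzero ones have two nonzero rows. A word x is in the dual of the product iff each
combination of its rows by a word of C₁ lies in C*. If x has weight below 3, sums of two rows are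
too light to be nonzero in C*, so all rows agree and the weight is a multiple of 3, hence 0. -/

/-! ### Pauli operators: products, adjoints, traces -/

section PauliOperators

/-- The sign `(-1) ^ z` of a bit. -/
def bitSign (z : ZMod 2) : ℂ := (-1) ^ z.val

@[simp] lemma bitSign_zero : bitSign 0 = 1 := by simp [bitSign]

@[simp] lemma bitSign_one : bitSign 1 = -1 := by
  have : (1 : ZMod 2).val = 1 := rfl
  simp [bitSign, this]

lemma eq_zero_or_one_of_zmod_two (z : ZMod 2) : z = 0 ∨ z = 1 := by
  revert z; decide

lemma bitSign_add (x y : ZMod 2) : bitSign (x + y) = bitSign x * bitSign y := by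
  have h : (1 + 1 : ZMod 2) = 0 := rfl
  rcases eq_zero_or_one_of_zmod_two x with rfl | rfl <;>
    rcases eq_zero_or_one_of_zmod_two y with rfl | rfl <;> simp [h]

lemma bitSign_mul_self (x : ZMod 2) : bitSign x * bitSign x = 1 := by
  rw [← bitSign_add, CharTwo.add_self_eq_zero, bitSign_zero]

lemma bitSign_ne_zero (x : ZMod 2) : bitSign x ≠ 0 := by
  intro h; simpa [h] using bitSign_mul_self x

lemma star_bitSign (x : ZMod 2) : star (bitSign x) = bitSign x := by
  rcases eq_zero_or_one_of_zmod_two x with rfl | rfl <;> simp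

variable {ι : Type*}

lemma pi_zmod_two_add_self (c : ι → ZMod 2) : c + c = 0 :=
  funext fun i => CharTwo.add_self_eq_zero (c i)

variable [Fintype ι]

lemma pauli_apply (a b x y : ι → ZMod 2) :
    pauli a b x y = if x = y + a then bitSign (b ⬝ᵥ y) else 0 := rfl

lemma pauli_zero_zero : pauli (0 : ι → ZMod 2) 0 = 1 := by
  ext x y
  simp [pauli_apply, Matrix.one_apply]

lemma conjTranspose_pauli (a b : ι → ZMod 2) :
    (pauli a b)ᴴ = bitSign (b ⬝ᵥ a) • pauli a b := by
  ext x y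
  simp only [Matrix.conjTranspose_apply, pauli_apply, Matrix.smul_apply, smul_eq_mul]
  have : y = x + a ↔ x = y + a := by
    constructor <;> rintro rfl <;> rw [add_assoc, pi_zmod_two_add_self, add_zero]
  by_cases h : x = y + a
  · rw [if_pos (this.2 h), if_pos h, star_bitSign, ← bitSign_add, ← dotProduct_add, h, add_comm]
  · rw [if_neg (mt this.1 h), if_neg h]; simp

variable [DecidableEq ι]

lemma pauli_mul_pauli (a b a' b' : ι → ZMod 2) :
    pauli a b * pauli a' b' = bitSign (b ⬝ᵥ a') • pauli (a + a') (b + b') := by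
  ext x y
  simp only [Matrix.mul_apply, pauli_apply, Matrix.smul_apply, smul_eq_mul]
  rw [Finset.sum_eq_single (y + a')]
  · simp only [if_true, dotProduct_add, add_dotProduct, bitSign_add, add_assoc, add_comm a' a]
    split_ifs <;> ring
  · intro z _ hz
    simp [hz]
  · simp

/-- Translating y by a unit vector in the support of b flips every sign, so the sum equals its
negative. -/
lemma sum_bitSign_dotProduct {b : ι → ZMod 2} (hb : b ≠ 0) :
    ∑ y : ι → ZMod 2, bitSign (b ⬝ᵥ y) = 0 := by
  obtain ⟨i, hi⟩ := Function.ne_iff.1 hb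
  have hi1 : b i = 1 := (eq_zero_or_one_of_zmod_two (b i)).resolve_left hi
  have h := Equiv.sum_comp (Equiv.addRight (Pi.single i (1 : ZMod 2)))
    (fun y : ι → ZMod 2 => bitSign (b ⬝ᵥ y))
  simp only [Equiv.coe_addRight, dotProduct_add, bitSign_add, dotProduct_single, hi1, mul_one,
    bitSign_one, mul_neg, Finset.sum_neg_distrib] at h
  exact self_eq_neg.1 h.symm

lemma trace_pauli (a b : ι → ZMod 2) (h : ¬(a = 0 ∧ b = 0)) : (pauli a b).trace = 0 := by
  simp only [Matrix.trace, Matrix.diag, pauli_apply]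
  by_cases ha : a = 0
  · subst ha
    simpa using sum_bitSign_dotProduct (fun hb => h ⟨rfl, hb⟩)
  · simp [ha]

lemma conjTranspose_pauli_mul_self (a b : ι → ZMod 2) : (pauli a b)ᴴ * pauli a b = 1 := by
  rw [conjTranspose_pauli, Matrix.smul_mul, pauli_mul_pauli, smul_smul, bitSign_mul_self,
    pi_zmod_two_add_self, pi_zmod_two_add_self,
    pauli_zero_zero, one_smul]

lemma star_pauli_mulVec_dotProduct (a b : ι → ZMod 2) (φ ψ : QState ι) :
    star (pauli a b *ᵥ φ) ⬝ᵥ (pauli a b *ᵥ ψ) = star φ ⬝ᵥ ψ := by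
  rw [Matrix.star_mulVec, ← Matrix.dotProduct_mulVec, Matrix.mulVec_mulVec,
    conjTranspose_pauli_mul_self, Matrix.one_mulVec]

end PauliOperators

/-! ### Arithmetic and trace of GF(4) -/

section FieldFour

lemma natCard_F4 : Nat.card F4 = 4 := by
  rw [GaloisField.card 2 2 two_ne_zero]; norm_num

lemma card_F4 [Fintype F4] : Fintype.card F4 = 4 := by
  rw [← Nat.card_eq_fintype_card, natCard_F4]

lemma F4.pow_four (x : F4) : x ^ 4 = x := by
  have := Fintype.ofFinite F4
  rw [← card_F4, FiniteField.pow_card]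

lemma F4.pow_three {x : F4} (hx : x ≠ 0) : x ^ 3 = 1 := by
  have := Fintype.ofFinite F4
  have := FiniteField.pow_card_sub_one_eq_one x hx
  rwa [card_F4] at this

lemma F4.exists_primitive : ∃ ω : F4, ω ^ 2 + ω + 1 = 0 := by
  classical
  have := Fintype.ofFinite F4
  obtain ⟨ω, hω⟩ : ∃ ω : F4, ω ∉ ({0, 1} : Finset F4) := by
    by_contra! h
    have := Finset.card_le_card (fun x _ => h x : (Finset.univ : Finset F4) ⊆ {0, 1})
    rw [Finset.card_univ, card_F4] at this
    exact absurd (this.trans Finset.card_le_two) (by norm_num)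
  simp only [Finset.mem_insert, Finset.mem_singleton, not_or] at hω
  refine ⟨ω, (mul_eq_zero.1 ?_).resolve_left (sub_ne_zero.2 hω.2)⟩
  linear_combination F4.pow_three hω.1

lemma F4.two_eq_zero : (2 : F4) = 0 := CharTwo.two_eq_zero

lemma F4.algebraMap_trace (x : F4) :
    algebraMap (ZMod 2) F4 (Algebra.trace (ZMod 2) F4 x) = x + x ^ 2 := by
  rw [FiniteField.algebraMap_trace_eq_sum_pow, GaloisField.finrank 2 two_ne_zero]
  simp [Finset.sum_range_succ]

/-- The trace inner product in the coordinates with respect to `ω` and `ω ^ 2`. -/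
lemma F4.trace_mul_sq {ω : F4} (hω : ω ^ 2 + ω + 1 = 0) (x y : F4) :
    Algebra.trace (ZMod 2) F4 (x * y ^ 2) =
      Algebra.trace (ZMod 2) F4 (ω ^ 2 * x) * Algebra.trace (ZMod 2) F4 (ω * y) +
      Algebra.trace (ZMod 2) F4 (ω ^ 2 * y) * Algebra.trace (ZMod 2) F4 (ω * x) := by
  -- Inside GF(4) the trace is z + z², which leaves a polynomial identity modulo ω³ = 1 and y⁴ = y.
  apply (algebraMap (ZMod 2) F4).injective
  simp only [map_add, map_mul, F4.algebraMap_trace]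
  have h3 : ω ^ 3 = 1 := by linear_combination (ω - 1) * hω
  have e4 : ω ^ 4 = ω := by linear_combination ω * h3
  have e6 : ω ^ 6 = 1 := by linear_combination (ω ^ 3 + 1) * h3
  have e5 : ω ^ 5 = ω ^ 2 := by linear_combination ω ^ 2 * h3
  have hy := F4.pow_four y
  have h2 := F4.two_eq_zero
  ring_nf
  simp only [h3, e4, e5, e6, hy, h2]
  linear_combination (-(x * y ^ 2) - x ^ 2 * y) * hω + (x * y ^ 2 + x ^ 2 * y) * h2

/-- The basis ω, ω² is its own trace-dual: tr(ω²) = tr(ω⁴) = 1 and tr(ω³) = 0. -/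
lemma F4.eq_of_traces {ω : F4} (hω : ω ^ 2 + ω + 1 = 0) (a b : ZMod 2) :
    Algebra.trace (ZMod 2) F4 (ω * (a • ω + b • ω ^ 2)) = a ∧
      Algebra.trace (ZMod 2) F4 (ω ^ 2 * (a • ω + b • ω ^ 2)) = b := by
  have h3 : ω ^ 3 = 1 := by linear_combination (ω - 1) * hω
  have h2 := F4.two_eq_zero
  have hz (z : ZMod 2) : (algebraMap (ZMod 2) F4 z) ^ 2 = algebraMap (ZMod 2) F4 z := by
    rw [← map_pow]; congr 1; revert z; decide
  constructor <;> apply (algebraMap (ZMod 2) F4).injective <;>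
    rw [F4.algebraMap_trace, Algebra.smul_def, Algebra.smul_def] <;>
    generalize hA : algebraMap (ZMod 2) F4 a = A <;>
    generalize hB : algebraMap (ZMod 2) F4 b = B <;>
    have hA2 : A ^ 2 = A := hA ▸ hz a <;>
    have hB2 : B ^ 2 = B := hB ▸ hz b
  · linear_combination A * hω + (B + A * ω + B * (ω ^ 3 + 1)) * h3 + ω ^ 4 * hA2 + ω ^ 6 * hB2 -
      (A - B - A * B * ω ^ 5) * h2
  · linear_combination B * hω + (A + B * ω + A * (ω ^ 3 + 1) + B * ω ^ 2 * (ω ^ 3 + 1)) * h3 +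
      ω ^ 6 * hA2 + ω ^ 8 * hB2 - (B - A - A * B * ω ^ 7) * h2

lemma F4.eq_zero_of_traces {ω : F4} (hω : ω ^ 2 + ω + 1 = 0) {x : F4}
    (h1 : Algebra.trace (ZMod 2) F4 (ω * x) = 0)
    (h2 : Algebra.trace (ZMod 2) F4 (ω ^ 2 * x) = 0) : x = 0 := by
  have e1 := F4.algebraMap_trace (ω * x)
  have e2 := F4.algebraMap_trace (ω ^ 2 * x)
  rw [h1, map_zero] at e1
  rw [h2, map_zero] at e2
  have h3 : ω ^ 3 = 1 := by linear_combination (ω - 1) * hω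
  have ht := F4.two_eq_zero
  -- The combination `ω ^ 2 * e1 - e2` eliminates x².
  linear_combination ω ^ 2 * (ω ^ 2 * e1 - e2) + (ω ^ 2 * x - ω * x) * h3 + x * hω - ω * x * ht

end FieldFour

/-! ### Error operators of words over GF(4) -/

section ErrorOperators

variable {ι : Type*}

lemma exists_word_of_bits {ω : F4} (hω : ω ^ 2 + ω + 1 = 0) (a b : ι → ZMod 2) :
    ∃ v : ι → F4, (fun i => Algebra.trace (ZMod 2) F4 (ω * v i)) = a ∧
      (fun i => Algebra.trace (ZMod 2) F4 (ω ^ 2 * v i)) = b :=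
  ⟨fun i => a i • ω + b i • ω ^ 2, funext fun i => (F4.eq_of_traces hω (a i) (b i)).1,
    funext fun i => (F4.eq_of_traces hω (a i) (b i)).2⟩

variable [Fintype ι]

/-- The sign exponent in the product of the error operators of two words. -/
noncomputable def errorCocycle (ω : F4) (v w : ι → F4) : ZMod 2 :=
  (fun i => Algebra.trace (ZMod 2) F4 (ω ^ 2 * v i)) ⬝ᵥ
    (fun i => Algebra.trace (ZMod 2) F4 (ω * w i))

lemma errorOp_zero (ω : F4) : errorOp ω (0 : ι → F4) = 1 := by
  rw [← pauli_zero_zero]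
  simp only [errorOp, Pi.zero_apply, mul_zero, map_zero]
  rfl

lemma errorCocycle_add_swap {ω : F4} (hω : ω ^ 2 + ω + 1 = 0) (v w : ι → F4) :
    errorCocycle ω v w + errorCocycle ω w v =
      ∑ i, Algebra.trace (ZMod 2) F4 (v i * w i ^ 2) := by
  simp only [errorCocycle, dotProduct, ← Finset.sum_add_distrib, F4.trace_mul_sq hω]

lemma pauliWeight_eq_hammingNorm [DecidableEq F4] {ω : F4} (hω : ω ^ 2 + ω + 1 = 0) (v : ι → F4) :
    pauliWeight (fun i => Algebra.trace (ZMod 2) F4 (ω * v i))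
      (fun i => Algebra.trace (ZMod 2) F4 (ω ^ 2 * v i)) = hammingNorm v := by
  unfold pauliWeight hammingNorm
  congr 1
  ext i
  simp only [Finset.mem_filter, Finset.mem_univ, true_and]
  constructor
  · rintro h h0
    simp [h0] at h
  · intro h
    by_contra! h'
    exact h (F4.eq_zero_of_traces hω h'.1 h'.2)

variable [DecidableEq ι]

lemma errorOp_mul (ω : F4) (v w : ι → F4) :
    errorOp ω v * errorOp ω w = bitSign (errorCocycle ω v w) • errorOp ω (v + w) := by
  simp only [errorOp, pauli_mul_pauli, Pi.add_apply, mul_add, map_add]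
  rfl

lemma errorOp_comm {ω : F4} (hω : ω ^ 2 + ω + 1 = 0) (v w : ι → F4) :
    errorOp ω v * errorOp ω w =
      bitSign (∑ i, Algebra.trace (ZMod 2) F4 (v i * w i ^ 2)) • (errorOp ω w * errorOp ω v) := by
  rw [errorOp_mul, errorOp_mul, smul_smul, ← errorCocycle_add_swap hω, bitSign_add, mul_assoc,
    bitSign_mul_self, mul_one, add_comm w v]

lemma trace_errorOp {ω : F4} (hω : ω ^ 2 + ω + 1 = 0) {v : ι → F4} (hv : v ≠ 0) :
    (errorOp ω v).trace = 0 :=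
  trace_pauli _ _ fun h => hv <| funext fun i =>
    F4.eq_zero_of_traces hω (congrFun h.1 i) (congrFun h.2 i)

end ErrorOperators

/-! ### Stabilizer codes: existence, dimension, detectable errors -/

section StabilizerCodes

variable {ι : Type*} [Fintype ι] [DecidableEq ι] {ω : F4} {D : Submodule (ZMod 2) (ι → F4)}

/-- The square of the operator is ±1, so it is annihilated by the squarefree polynomial X² ∓ 1. This
makes generalized eigenspaces genuine ones. -/
lemma isSemisimple_errorOp (ω : F4) (v : ι → F4) :
    Module.End.IsSemisimple (Matrix.toLin' (errorOp ω v)) := by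
  have hsq : errorOp ω v * errorOp ω v = bitSign (errorCocycle ω v v) • 1 := by
    rw [errorOp_mul, ← errorOp_zero ω]
    congr 2
    exact funext fun i => CharTwo.add_self_eq_zero (v i)
  refine Module.End.isSemisimple_of_squarefree_aeval_eq_zero
    (p := Polynomial.X ^ 2 - Polynomial.C (bitSign (errorCocycle ω v v))) ?_ ?_
  · exact (Polynomial.separable_X_pow_sub_C _ two_ne_zero (bitSign_ne_zero _)).squarefree
  · rw [map_sub, map_pow, Polynomial.aeval_X, Polynomial.aeval_C, sq, Module.End.mul_eq_comp,
      ← Matrix.toLin'_mul, hsq, map_smul, Matrix.toLin'_one, Algebra.algebraMap_eq_smul_one,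
      Module.End.one_eq_id, sub_self]

open Classical in
/-- Commuting error operators have a joint eigenspace. -/
theorem exists_isStabilizerCodeOf (hω : ω ^ 2 + ω + 1 = 0) (hD : D ≤ symplecticDual D) :
    ∃ Q : Submodule ℂ (QState ι), IsStabilizerCodeOf ω D Q := by
  let f : D → Module.End ℂ (QState ι) := fun v => Matrix.toLin' (errorOp ω v)
  have hcomm : Pairwise fun v w => Commute (f v) (f w) := by
    intro v w _
    have h := errorOp_comm hω v.1 w.1
    rw [hD v.2 w w.2, bitSign_zero, one_smul] at h
    simp only [f, Commute, SemiconjBy, Module.End.mul_eq_comp, ← Matrix.toLin'_mul, h]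
  -- Over ℂ the joint generalized eigenspaces of a commuting family span everything, so one of them
  -- is nonzero.
  have htop := Module.End.iSup_iInf_maxGenEigenspace_eq_top_of_iSup_maxGenEigenspace_eq_top_of_commute
    f hcomm (fun v => Module.End.iSup_maxGenEigenspace_eq_top (f v))
  obtain ⟨χ, hχ⟩ : ∃ χ : D → ℂ, ⨅ v, (f v).maxGenEigenspace (χ v) ≠ ⊥ := by
    by_contra! h
    simp only [h, iSup_bot] at htop
    exact bot_ne_top htop
  -- The value 0 off `D` is a dummy: only eigenvalues on `D` are ever read.
  refine ⟨_, hχ, fun v => if h : v ∈ D then χ ⟨v, h⟩ else 0, fun ψ => ?_⟩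
  have hss (v : D) := (isSemisimple_errorOp ω v.1).isFinitelySemisimple
  simp only [Submodule.mem_iInf, Subtype.forall]
  refine forall₂_congr fun v hv => ?_
  simp only [f]
  rw [(hss ⟨v, hv⟩).maxGenEigenspace_eq_eigenspace, Module.End.mem_eigenspace_iff, dif_pos hv,
    Matrix.toLin'_apply]

/-- The projection onto the joint eigenspace with eigenvalues `χ`. -/
noncomputable def stabilizerProjection (ω : F4) (D : Submodule (ZMod 2) (ι → F4))
    [Fintype D] (χ : (ι → F4) → ℂ) : Matrix (ι → ZMod 2) (ι → ZMod 2) ℂ :=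
  (Fintype.card D : ℂ)⁻¹ • ∑ v : D, (χ v)⁻¹ • errorOp ω (v : ι → F4)

/-- Every term is a multiple of the operator of e + v, and e + v ≠ 0 because e is not in `D`. -/
lemma trace_errorOp_mul_stabilizerProjection [Fintype D] (χ : (ι → F4) → ℂ)
    (hω : ω ^ 2 + ω + 1 = 0) {e : ι → F4}
    (he : e ∉ D) :
    (errorOp ω e * stabilizerProjection ω D χ).trace = 0 := by
  simp only [stabilizerProjection, Matrix.mul_smul, Matrix.mul_sum, Matrix.trace_smul,
    Matrix.trace_sum, errorOp_mul]
  rw [Finset.sum_eq_zero fun v _ => ?_, smul_zero]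
  rw [trace_errorOp hω, smul_zero, smul_zero]
  intro h
  rw [add_eq_zero_iff_eq_neg] at h
  exact he (h ▸ D.neg_mem v.2)

open scoped ComplexOrder in
lemma star_dotProduct_self_eq_zero {φ : QState ι} : star φ ⬝ᵥ φ = 0 ↔ φ = 0 :=
  dotProduct_star_self_eq_zero

section Character

variable {Q : Submodule ℂ (QState ι)} {χ : (ι → F4) → ℂ}
  (hQ : ∀ ψ : QState ι, ψ ∈ Q ↔ ∀ v ∈ D, errorOp ω v *ᵥ ψ = χ v • ψ)

include hQ

lemma detects_of_mem {e : ι → F4} (he : e ∈ D) : Detects Q (errorOp ω e) :=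
  ⟨χ e, fun φ _ ψ hψ => by rw [(hQ ψ).1 hψ e he, dotProduct_smul, smul_eq_mul]⟩

variable (hne : Q ≠ ⊥)

include hne

lemma eigenvalue_mul {v w : ι → F4} (hv : v ∈ D) (hw : w ∈ D) :
    χ v * χ w = bitSign (errorCocycle ω v w) * χ (v + w) := by
  obtain ⟨ψ, hψ, h0⟩ := Q.ne_bot_iff.1 hne
  have h := (hQ ψ).1 hψ
  have h1 := congrArg (· *ᵥ ψ) (errorOp_mul ω v w)
  simp only [← Matrix.mulVec_mulVec, Matrix.smul_mulVec, h w hw, h v hv, Matrix.mulVec_smul,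
    h _ (D.add_mem hv hw), smul_smul] at h1
  rw [mul_comm]
  exact smul_left_injective ℂ h0 h1

lemma eigenvalue_zero : χ 0 = 1 := by
  obtain ⟨ψ, hψ, h0⟩ := Q.ne_bot_iff.1 hne
  have h := (hQ ψ).1 hψ 0 D.zero_mem
  rw [errorOp_zero, Matrix.one_mulVec] at h
  exact smul_left_injective ℂ h0 (by simpa using h.symm)

lemma eigenvalue_ne_zero {v : ι → F4} (hv : v ∈ D) : χ v ≠ 0 := by
  intro h
  have h1 := eigenvalue_mul hQ hne hv hv
  have h2 : v + v = 0 := funext fun i => CharTwo.add_self_eq_zero (v i)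
  rw [h, h2, eigenvalue_zero hQ hne, zero_mul, mul_one] at h1
  exact bitSign_ne_zero _ h1.symm

/-- Multiplying by the operator of w permutes the terms by v ↦ w + v, and `eigenvalue_mul` absorbs
the signs into a factor χ(w); so the image lies in `Q`. On `Q` each term of the average is the
identity. -/
lemma isProj_stabilizerProjection [Fintype D] :
    LinearMap.IsProj Q (Matrix.toLin' (stabilizerProjection ω D χ)) := by
  have hc : (Fintype.card D : ℂ) ≠ 0 := by simp
  constructor
  · intro ψ
    rw [Matrix.toLin'_apply, hQ]
    intro w hw
    have hsum : ∑ v : D, (χ v)⁻¹ • (errorOp ω w * errorOp ω (v : ι → F4)) =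
        ∑ v : D, χ w • (χ v)⁻¹ • errorOp ω (v : ι → F4) := by
      refine Fintype.sum_equiv (Equiv.addLeft (⟨w, hw⟩ : D)) _ _ fun v => ?_
      rw [errorOp_mul, smul_smul, smul_smul, Equiv.coe_addLeft, Submodule.coe_add]
      refine congrArg (· • errorOp ω (w + (v : ι → F4))) ?_
      have h1 := eigenvalue_ne_zero hQ hne v.2
      have h2 := eigenvalue_ne_zero hQ hne (D.add_mem hw v.2)
      have h3 := eigenvalue_mul hQ hne hw v.2
      field_simp
      linear_combination -h3
    rw [Matrix.mulVec_mulVec, ← Matrix.smul_mulVec, stabilizerProjection, Matrix.mul_smul,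
      Matrix.mul_sum, smul_comm (χ w), Finset.smul_sum (r := χ w), ← hsum]
    simp only [Matrix.mul_smul]
  · intro ψ hψ
    have h := (hQ ψ).1 hψ
    have h1 (v : D) : (χ v)⁻¹ • errorOp ω (v : ι → F4) *ᵥ ψ = ψ := by
      rw [h v v.2, smul_smul, inv_mul_cancel₀ (eigenvalue_ne_zero hQ hne v.2), one_smul]
    rw [Matrix.toLin'_apply, stabilizerProjection, Matrix.smul_mulVec, Matrix.sum_mulVec]
    simp only [Matrix.smul_mulVec, h1, Finset.sum_const, Finset.card_univ]
    rw [← Nat.cast_smul_eq_nsmul ℂ, smul_smul, inv_mul_cancel₀ hc, one_smul]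

/-- The dimension is the trace of the projection, to which only v = 0 contributes. -/
lemma finrank_mul_card (hω : ω ^ 2 + ω + 1 = 0) :
    Module.finrank ℂ Q * Nat.card D = 2 ^ Fintype.card ι := by
  have := Fintype.ofFinite D
  have hsum : ∑ v : D, ((χ v)⁻¹ • errorOp ω (v : ι → F4)).trace = 2 ^ Fintype.card ι := by
    rw [Finset.sum_eq_single_of_mem (0 : D) (Finset.mem_univ _)]
    · rw [ZeroMemClass.coe_zero, eigenvalue_zero hQ hne, errorOp_zero, inv_one, one_smul,
        Matrix.trace_one]
      simp
    · intro v _ hv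
      rw [Matrix.trace_smul, trace_errorOp hω (by simpa using hv), smul_zero]
  have h := (isProj_stabilizerProjection hQ hne).trace
  rw [Matrix.trace_toLin'_eq, stabilizerProjection, Matrix.trace_smul, Matrix.trace_sum, hsum,
    smul_eq_mul] at h
  have hc : (Fintype.card D : ℂ) ≠ 0 := by simp
  have h' : (Module.finrank ℂ Q * Fintype.card D : ℂ) = 2 ^ Fintype.card ι := by
    rw [← h]; field_simp
  rw [Nat.card_eq_fintype_card]
  exact_mod_cast h'

/-- An error of a word outside of the symplectic dual is detected, as it maps the code to
an orthogonal space. -/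
lemma detects_of_notMem_symplecticDual (hω : ω ^ 2 + ω + 1 = 0) {e : ι → F4}
    (he : e ∉ symplecticDual D) : Detects Q (errorOp ω e) := by
  obtain ⟨w, hw, hne1⟩ : ∃ w ∈ D, ∑ i, Algebra.trace (ZMod 2) F4 (e i * w i ^ 2) ≠ 0 := by
    by_contra! h
    exact he h
  have h1 := (eq_zero_or_one_of_zmod_two _).resolve_left hne1
  have hanti := errorOp_comm hω e w
  rw [h1, bitSign_one, neg_one_smul] at hanti
  refine ⟨0, fun φ hφ ψ hψ => ?_⟩
  have hφ' := (hQ φ).1 hφ w hw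
  have hψ' := (hQ ψ).1 hψ w hw
  have hunit (φ ψ : QState ι) : star (errorOp ω w *ᵥ φ) ⬝ᵥ (errorOp ω w *ᵥ ψ) = star φ ⬝ᵥ ψ :=
    star_pauli_mulVec_dotProduct _ _ φ ψ
  have hχ : star (χ w) * χ w = 1 := by
    obtain ⟨θ, hθ, h0⟩ := Q.ne_bot_iff.1 hne
    have h := hunit θ θ
    rw [(hQ θ).1 hθ w hw, star_smul, smul_dotProduct, dotProduct_smul, smul_smul, smul_eq_mul] at h
    have h0' : star θ ⬝ᵥ θ ≠ 0 := by
      rwa [Ne, star_dotProduct_self_eq_zero]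
    exact mul_right_cancel₀ h0' (by rw [h, one_mul])
  -- Applying the unitary operator of w to both sides of ⟨φ|E|ψ⟩ preserves it, while anticommutation
  -- and |χ(w)| = 1 turn it into its negative.
  have h2 := hunit φ (errorOp ω e *ᵥ ψ)
  rw [Matrix.mulVec_mulVec, ← neg_eq_iff_eq_neg.2 hanti, Matrix.neg_mulVec, ← Matrix.mulVec_mulVec,
    hφ', hψ', Matrix.mulVec_smul, star_smul, smul_dotProduct, dotProduct_neg, dotProduct_smul,
    smul_neg, smul_smul, hχ, one_smul] at h2
  rw [zero_mul]
  exact self_eq_neg.1 h2.symm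

/-- An error of a word in the symplectic dual but not in the code is a non-trivial operation
of the code space. -/
lemma not_detects_of_mem_symplecticDual (hω : ω ^ 2 + ω + 1 = 0) {e : ι → F4}
    (he : e ∈ symplecticDual D) (heD : e ∉ D) : ¬ Detects Q (errorOp ω e) := by
  rintro ⟨c, hc⟩
  have hmaps : ∀ ψ ∈ Q, errorOp ω e *ᵥ ψ ∈ Q := by
    intro ψ hψ
    rw [hQ]
    intro w hw
    have h := errorOp_comm hω e w
    rw [he w hw, bitSign_zero, one_smul] at h
    rw [Matrix.mulVec_mulVec, ← h, ← Matrix.mulVec_mulVec, (hQ ψ).1 hψ w hw, Matrix.mulVec_smul]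
  -- The difference Eψ − cψ lies in `Q`, and detection makes it orthogonal to all of `Q`, hence to
  -- itself.
  have hscalar : ∀ ψ ∈ Q, errorOp ω e *ᵥ ψ = c • ψ := by
    intro ψ hψ
    rw [← sub_eq_zero]
    have hmem := Q.sub_mem (hmaps ψ hψ) (Q.smul_mem c hψ)
    have := hc _ hmem ψ hψ
    rw [← star_dotProduct_self_eq_zero, dotProduct_sub, dotProduct_smul, this, smul_eq_mul, sub_self]
  have := Fintype.ofFinite D
  have hproj := isProj_stabilizerProjection hQ hne
  have hEP : errorOp ω e * stabilizerProjection ω D χ = c • stabilizerProjection ω D χ := by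
    refine Matrix.toLin'.injective (LinearMap.ext fun ψ => ?_)
    have h := hscalar _ (hproj.map_mem ψ)
    rw [Matrix.toLin'_mul, map_smul]
    exact h
  -- Comparing traces gives c · dim Q = 0; but c = 0 contradicts unitarity and dim Q = 0 contradicts
  -- the dimension formula.
  have htr := trace_errorOp_mul_stabilizerProjection χ hω heD
  rw [hEP, Matrix.trace_smul, ← Matrix.trace_toLin'_eq, hproj.trace, smul_eq_mul, mul_eq_zero] at htr
  have hpos := finrank_mul_card hQ hne hω
  rcases htr with rfl | h
  · obtain ⟨ψ, hψ, h0⟩ := Q.ne_bot_iff.1 hne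
    have h : star (errorOp ω e *ᵥ ψ) ⬝ᵥ (errorOp ω e *ᵥ ψ) = star ψ ⬝ᵥ ψ :=
      star_pauli_mulVec_dotProduct _ _ ψ ψ
    rw [hscalar ψ hψ, zero_smul, dotProduct_zero] at h
    exact h0 (star_dotProduct_self_eq_zero.1 h.symm)
  · rw [Nat.cast_eq_zero.1 h, zero_mul] at hpos
    exact absurd hpos.symm (by positivity)

end Character

theorem IsStabilizerCodeOf.finrank_mul_card {Q : Submodule ℂ (QState ι)}
    (hQ : IsStabilizerCodeOf ω D Q) (hω : ω ^ 2 + ω + 1 = 0) :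
    Module.finrank ℂ Q * Nat.card D = 2 ^ Fintype.card ι := by
  obtain ⟨hne, χ, hχ⟩ := hQ
  exact _root_.finrank_mul_card hχ hne hω

theorem IsStabilizerCodeOf.detects_iff {Q : Submodule ℂ (QState ι)}
    (hQ : IsStabilizerCodeOf ω D Q) (hω : ω ^ 2 + ω + 1 = 0) (e : ι → F4) :
    Detects Q (errorOp ω e) ↔ e ∉ symplecticDual D ∨ e ∈ D := by
  obtain ⟨hne, χ, hχ⟩ := hQ
  refine ⟨fun h => ?_, ?_⟩
  · by_contra! h'
    exact not_detects_of_mem_symplecticDual hχ hne hω h'.1 h'.2 h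
  · rintro (h | h)
    · exact detects_of_notMem_symplecticDual hχ hne hω h
    · exact detects_of_mem hχ h

open Classical in
theorem IsStabilizerCodeOf.isQECC {Q : Submodule ℂ (QState ι)}
    (hQ : IsStabilizerCodeOf ω D Q) (hω : ω ^ 2 + ω + 1 = 0) {n k d m : ℕ}
    (hn : Fintype.card ι = n) (hcard : Nat.card D = 2 ^ m) (hk : k + m = n)
    (hd : IsLeast {t | ∃ e ∈ symplecticDual D, e ∉ D ∧ hammingNorm e = t} d) :
    IsQECC Q n k d := by
  refine ⟨hn, ?_, ?_⟩
  · have h := hQ.finrank_mul_card hω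
    rw [hcard, hn, ← hk, pow_add] at h
    exact Nat.eq_of_mul_eq_mul_right (by positivity) h
  · convert hd using 1
    ext t
    constructor
    · rintro ⟨a, b, rfl, h⟩
      obtain ⟨v, rfl, rfl⟩ := exists_word_of_bits hω a b
      have h' := mt (hQ.detects_iff hω v).2 h
      push Not at h'
      exact ⟨v, h'.1, h'.2, (pauliWeight_eq_hammingNorm hω v).symm⟩
    · rintro ⟨v, hv, hvD, rfl⟩
      refine ⟨_, _, pauliWeight_eq_hammingNorm hω v, fun h => ?_⟩
      rcases (hQ.detects_iff hω v).1 h with h | h <;> contradiction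

end StabilizerCodes

/-! ### Duality for the symplectic and Hermitian forms -/

section SymplecticForm

variable {ι : Type*} [Fintype ι]

lemma F4.trace_mul_sq_comm (x y : F4) :
    Algebra.trace (ZMod 2) F4 (x * y ^ 2) = Algebra.trace (ZMod 2) F4 (y * x ^ 2) := by
  obtain ⟨ω, hω⟩ := F4.exists_primitive
  rw [F4.trace_mul_sq hω, F4.trace_mul_sq hω, add_comm]

/-- The symplectic (trace) inner product as a bilinear form over `GF(2)`. -/
noncomputable def symplecticForm (ι : Type*) [Fintype ι] :
    LinearMap.BilinForm (ZMod 2) (ι → F4) :=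
  LinearMap.mk₂ (ZMod 2) (fun v w => ∑ i, Algebra.trace (ZMod 2) F4 (v i * w i ^ 2))
    (fun v v' w => by simp [add_mul, Finset.sum_add_distrib])
    (fun c v w => by simp [← Finset.mul_sum])
    (fun v w w' => by simp [CharTwo.add_sq, mul_add, Finset.sum_add_distrib])
    (fun c v w => by
      simp_rw [F4.trace_mul_sq_comm (v _)]
      simp [← Finset.mul_sum])

lemma symplecticForm_apply (v w : ι → F4) :
    symplecticForm ι v w = ∑ i, Algebra.trace (ZMod 2) F4 (v i * w i ^ 2) := rfl

lemma symplecticForm_isSymm : (symplecticForm ι).IsSymm :=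
  ⟨fun v w => by simp [symplecticForm_apply, F4.trace_mul_sq_comm (v _)]⟩

lemma symplecticForm_nondegenerate : (symplecticForm ι).Nondegenerate := by
  classical
  refine (LinearMap.IsRefl.nondegenerate_iff_separatingLeft symplecticForm_isSymm.isRefl).2 ?_
  intro v hv
  obtain ⟨ω, hω⟩ := F4.exists_primitive
  have h3 : ω ^ 3 = 1 := by linear_combination (ω - 1) * hω
  have key (i : ι) (y : F4) : Algebra.trace (ZMod 2) F4 (y ^ 2 * v i) = 0 := by
    have h := hv (Pi.single i y)
    rw [symplecticForm_apply, Finset.sum_eq_single i] at h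
    · simpa [mul_comm] using h
    · intro j _ hj
      simp [hj]
    · simp
  funext i
  refine F4.eq_zero_of_traces hω ?_ (key i ω)
  -- Squaring swaps ω and ω², so y = ω² supplies the trace against ω.
  have h4 : (ω ^ 2) ^ 2 = ω := by linear_combination ω * h3
  exact h4 ▸ key i (ω ^ 2)

lemma symplecticDual_eq_orthogonal (D : Submodule (ZMod 2) (ι → F4)) :
    symplecticDual D = (symplecticForm ι).orthogonal D := by
  ext v
  refine forall₂_congr fun w _ => ?_
  change symplecticForm ι v w = 0 ↔ symplecticForm ι w v = 0
  rw [symplecticForm_isSymm.eq w v]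

lemma symplecticDual_symplecticDual (D : Submodule (ZMod 2) (ι → F4)) :
    symplecticDual (symplecticDual D) = D := by
  rw [symplecticDual_eq_orthogonal, symplecticDual_eq_orthogonal,
    LinearMap.BilinForm.orthogonal_orthogonal symplecticForm_nondegenerate
      symplecticForm_isSymm.isRefl]

lemma natCard_mul_natCard_symplecticDual (D : Submodule (ZMod 2) (ι → F4)) :
    Nat.card D * Nat.card (symplecticDual D) = 4 ^ Fintype.card ι := by
  have hle := D.finrank_le
  rw [Module.natCard_eq_pow_finrank (K := ZMod 2) (V := D),
    Module.natCard_eq_pow_finrank (K := ZMod 2) (V := symplecticDual D), ← pow_add,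
    symplecticDual_eq_orthogonal, LinearMap.BilinForm.finrank_orthogonal symplecticForm_nondegenerate,
    Nat.add_sub_cancel' hle, ← Module.natCard_eq_pow_finrank, Nat.card_pi]
  simp [natCard_F4]

/-- Scaling w by c multiplies the Hermitian product by c², so if all traces vanish, the product
itself does. -/
lemma restrictScalars_hermitianDual (C : Submodule F4 (ι → F4)) :
    (hermitianDual C).restrictScalars (ZMod 2) = symplecticDual (C.restrictScalars (ZMod 2)) := by
  ext v
  constructor
  · intro h w hw
    rw [← map_sum, h w hw, map_zero]
  · intro h w hw
    obtain ⟨ω, hω⟩ := F4.exists_primitive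
    have key (c : F4) : Algebra.trace (ZMod 2) F4 (c ^ 2 * ∑ i, v i * w i ^ 2) = 0 := by
      have := h (c • w) (C.smul_mem c hw)
      rw [← map_sum] at this
      rw [← this, Finset.mul_sum]
      congr 1
      refine Finset.sum_congr rfl fun i _ => ?_
      simp only [Pi.smul_apply, smul_eq_mul]
      ring
    refine F4.eq_zero_of_traces hω ?_ (key ω)
    have h4 : (ω ^ 2) ^ 2 = ω := by linear_combination (ω * (ω - 1)) * hω
    exact h4 ▸ key (ω ^ 2)

lemma hermitianDual_hermitianDual (C : Submodule F4 (ι → F4)) :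
    hermitianDual (hermitianDual C) = C := by
  apply Submodule.restrictScalars_injective (ZMod 2)
  rw [restrictScalars_hermitianDual, restrictScalars_hermitianDual, symplecticDual_symplecticDual]

lemma natCard_eq_four_pow_finrank (C : Submodule F4 (ι → F4)) :
    Nat.card C = 4 ^ Module.finrank F4 C := by
  rw [Module.natCard_eq_pow_finrank (K := F4), natCard_F4]

lemma finrank_add_finrank_hermitianDual (C : Submodule F4 (ι → F4)) :
    Module.finrank F4 C + Module.finrank F4 (hermitianDual C) = Fintype.card ι := by
  have h := natCard_mul_natCard_symplecticDual (C.restrictScalars (ZMod 2))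
  rw [← restrictScalars_hermitianDual] at h
  change Nat.card C * Nat.card (hermitianDual C) = _ at h
  rw [natCard_eq_four_pow_finrank, natCard_eq_four_pow_finrank, ← pow_add] at h
  exact Nat.pow_right_injective (by norm_num) h

end SymplecticForm

/-! ### Minimum weight and even codes -/

section MinimumDistance

variable {ι : Type*} [Fintype ι]

open Classical in
lemma hasMinDist_iff {A : Type*} [AddGroup A] {D : Set (ι → A)} {d : ℕ} (h0 : 0 ∈ D)
    (hsub : ∀ x ∈ D, ∀ y ∈ D, x - y ∈ D) :
    HasMinDist D d ↔ IsLeast {t | ∃ x ∈ D, x ≠ 0 ∧ hammingNorm x = t} d := by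
  unfold HasMinDist
  convert Iff.rfl using 2
  ext t
  constructor
  · rintro ⟨x, hx, hne, rfl⟩
    exact ⟨x, hx, 0, h0, hne, by rw [hammingDist_zero_right]⟩
  · rintro ⟨x, hx, y, hy, hne, rfl⟩
    refine ⟨x - y, hsub x hx y hy, sub_ne_zero.2 hne, ?_⟩
    simp [hammingNorm, hammingDist, sub_eq_zero]

open Classical in
/-- Self-orthogonality of even codes over `GF(4)`. -/
lemma le_hermitianDual_of_even {C : Submodule F4 (ι → F4)}
    (h : ∀ w ∈ C, Even (hammingNorm w)) : C ≤ hermitianDual C := by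
  -- Nonzero elements have cube 1, so the Hermitian norm is the weight modulo 2.
  have hq : ∀ w ∈ C, ∑ i, w i * w i ^ 2 = 0 := by
    intro w hw
    have h1 (i : ι) : w i * w i ^ 2 = if w i ≠ 0 then 1 else 0 := by
      split_ifs with h0
      · rw [← F4.pow_three h0]; ring
      · simp [not_not.1 h0]
    simp only [h1, Finset.sum_boole]
    obtain ⟨k, hk⟩ := h w hw
    change ((hammingNorm w : ℕ) : F4) = 0
    rw [hk, Nat.cast_add, CharTwo.add_self_eq_zero]
  obtain ⟨ω, hω⟩ := F4.exists_primitive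
  intro v hv w hw
  -- Polarization: the norm of c v + w leaves only the cross terms. Taking c = ω and c = 1 then
  -- separates the two conjugate sums.
  have key (c : F4) : c * ∑ i, v i * w i ^ 2 + c ^ 2 * ∑ i, w i * v i ^ 2 = 0 := by
    have h1 := hq _ (C.add_mem (C.smul_mem c hv) hw)
    have h2 := hq _ (C.smul_mem c hv)
    have h3 := hq _ hw
    simp only [Pi.add_apply, Pi.smul_apply, smul_eq_mul, CharTwo.add_sq] at h1 h2
    have e : ∀ i, (c * v i + w i) * ((c * v i) ^ 2 + w i ^ 2) = c * v i * (c * v i) ^ 2 +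
        w i * w i ^ 2 + (c * (v i * w i ^ 2) + c ^ 2 * (w i * v i ^ 2)) := fun i => by ring
    simp only [e, Finset.sum_add_distrib, h2, h3, ← Finset.mul_sum] at h1
    simpa using h1
  linear_combination key ω - ω ^ 2 * key 1 + (∑ i, v i * w i ^ 2) * hω -
    ω * (∑ i, v i * w i ^ 2) * F4.two_eq_zero

end MinimumDistance

/-! ### Points of the projective line and parity check matrices -/

section ProjectiveLine

variable {F : Type*} [Field F]

lemma projectivization_mk_eq_mk_iff_det {p c : Fin 2 → F} (hp : p ≠ 0) (hc : c ≠ 0) :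
    Projectivization.mk F p hp = Projectivization.mk F c hc ↔ p 0 * c 1 - p 1 * c 0 = 0 := by
  rw [Projectivization.mk_eq_mk_iff']
  constructor
  · rintro ⟨a, rfl⟩
    simp only [Pi.smul_apply, smul_eq_mul]
    ring
  · intro h
    by_cases h0 : c 0 = 0
    · have h1 : c 1 ≠ 0 := fun h1 => hc (by ext i; fin_cases i <;> simp [h0, h1])
      refine ⟨p 1 / c 1, ?_⟩
      have hp0 : p 0 = 0 := by simpa [h0, h1] using h
      ext i
      fin_cases i <;> simp [h0, h1, hp0]
    · refine ⟨p 0 / c 0, ?_⟩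
      ext i
      fin_cases i
      · simp [h0]
      · simp only [Fin.mk_one, Pi.smul_apply, smul_eq_mul]
        field_simp
        linear_combination h

/-- There is a Hamming code of redundancy 2, whose length is the number of points of the
projective line. -/
theorem exists_isHammingCode_two [Finite F] {n : ℕ} (hn : n = Nat.card F + 1) :
    ∃ H : Submodule F (Fin n → F), IsHammingCode 2 H := by
  have hcard : Nat.card (Projectivization F (Fin 2 → F)) = n := by
    rw [Projectivization.card_of_finrank_two F (Fin 2 → F) (by simp), hn]
  let e : Projectivization F (Fin 2 → F) ≃ Fin n := Finite.equivFinOfCardEq hcard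
  let M : Matrix (Fin 2) (Fin n) F := Matrix.of fun r i => (e.symm i).rep r
  have hcol (i : Fin n) : M.col i = (e.symm i).rep := rfl
  have h0 (i : Fin n) : M.col i ≠ 0 := by
    rw [hcol]; exact (e.symm i).rep_nonzero
  refine ⟨_, M, h0, ?_, rfl⟩
  convert e.symm.bijective using 2 with i
  exact (e.symm i).mk_rep

variable {ι : Type*} [Fintype ι]

open Classical in
/-- A code whose parity check matrix has pairwise independent columns has minimum distance at
least 3. -/
lemma three_le_hammingNorm_of_mulVec_eq_zero {M : Matrix (Fin 2) ι F} (h0 : ∀ i, M.col i ≠ 0)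
    (hinj : Function.Injective fun i => Projectivization.mk F (M.col i) (h0 i)) {v : ι → F}
    (hv : M *ᵥ v = 0) (hne : v ≠ 0) : 3 ≤ hammingNorm v := by
  by_contra! hlt
  obtain ⟨i, hi⟩ := Function.ne_iff.1 hne
  obtain ⟨j, hij, hvj⟩ : ∃ j, i ≠ j ∧ v j ≠ 0 := by
    by_contra! h
    refine h0 i (funext fun r => (mul_eq_zero.1 ?_).resolve_right hi)
    have h1 := congrFun hv r
    rwa [Matrix.mulVec, dotProduct, Fintype.sum_eq_single i] at h1
    intro j hj
    rw [h j hj.symm, mul_zero]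
  have hj (k : ι) (hki : k ≠ i) (hkj : k ≠ j) : v k = 0 := by
    by_contra hk
    have hle : ({i, j, k} : Finset ι).card ≤ hammingNorm v := by
      refine Finset.card_le_card fun l hl => ?_
      simp only [Finset.mem_insert, Finset.mem_singleton] at hl
      rw [Finset.mem_filter]
      refine ⟨Finset.mem_univ _, ?_⟩
      rcases hl with rfl | rfl | rfl <;> assumption
    rw [Finset.card_eq_three.2 ⟨i, j, k, hij, hki.symm, hkj.symm, rfl⟩] at hle
    omega
  have hsum (r : Fin 2) : M r i * v i + M r j * v j = 0 := by
    have h := congrFun hv r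
    rw [Matrix.mulVec, dotProduct, ← Finset.sum_subset (Finset.subset_univ {i, j})] at h
    · rwa [Finset.sum_pair hij] at h
    · intro k _ hk
      simp only [Finset.mem_insert, Finset.mem_singleton, not_or] at hk
      rw [hj k hk.1 hk.2, mul_zero]
  -- With support in {i, j}, the two check equations force the 2×2 minor of these columns to vanish,
  -- making them the same point.
  refine hij (hinj ((projectivization_mk_eq_mk_iff_det (h0 i) (h0 j)).2 ?_))
  refine (mul_eq_zero.1 ?_).resolve_right hi
  simp only [Matrix.col_apply]
  linear_combination M 1 j * hsum 0 - M 0 j * hsum 1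

end ProjectiveLine

/-! ### The quaternary Hamming code and its Hermitian dual -/

section HammingCodes

/-- The words of the code dual to a Hamming code of redundancy 2 over `GF(4)`, for the
Hermitian inner product: conjugates of linear combinations of the rows of the parity check matrix. -/
noncomputable def conjRowMap {ι : Type*} (M : Matrix (Fin 2) ι F4) :
    (Fin 2 → F4) →ₗ[F4] (ι → F4) :=
  ((M.map (· ^ 2))ᵀ).mulVecLin

lemma conjRowMap_apply {ι : Type*} (M : Matrix (Fin 2) ι F4) (x : Fin 2 → F4) (i : ι) :
    conjRowMap M x i = M 0 i ^ 2 * x 0 + M 1 i ^ 2 * x 1 := by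
  simp only [conjRowMap, Matrix.mulVecLin_apply, Matrix.mulVec, dotProduct, Fin.sum_univ_two,
    Matrix.transpose_apply, Matrix.map_apply]

/-- Since a⁴ = a, conjugating the rows twice restores them: the Hermitian product with v is the
combination of the syndromes of v with coefficients x_r². -/
lemma hermitianDual_range_conjRowMap {ι : Type*} [Fintype ι] (M : Matrix (Fin 2) ι F4) :
    hermitianDual (LinearMap.range (conjRowMap M)) = LinearMap.ker M.mulVecLin := by
  ext v
  have key (x : Fin 2 → F4) : ∑ i, v i * conjRowMap M x i ^ 2 =
      x 0 ^ 2 * (M *ᵥ v) 0 + x 1 ^ 2 * (M *ᵥ v) 1 := by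
    simp only [Matrix.mulVec, dotProduct, Finset.mul_sum, ← Finset.sum_add_distrib]
    refine Finset.sum_congr rfl fun i _ => ?_
    rw [conjRowMap_apply, CharTwo.add_sq]
    linear_combination v i * x 0 ^ 2 * F4.pow_four (M 0 i) + v i * x 1 ^ 2 * F4.pow_four (M 1 i)
  rw [LinearMap.mem_ker, Matrix.mulVecLin_apply]
  constructor
  · intro h
    ext r
    have h' (x : Fin 2 → F4) := (key x).symm.trans (h _ ⟨x, rfl⟩)
    fin_cases r
    · simpa using h' (Pi.single 0 1)
    · simpa using h' (Pi.single 1 1)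
  · rintro h w ⟨x, rfl⟩
    rw [key, h]
    simp

open Classical in
lemma hammingNorm_conjRowMap {M : Matrix (Fin 2) (Fin 5) F4} (h0 : ∀ i, M.col i ≠ 0)
    (hbij : Function.Bijective fun i => Projectivization.mk F4 (M.col i) (h0 i))
    {x : Fin 2 → F4} (hx : x ≠ 0) : hammingNorm (conjRowMap M x) = 4 := by
  -- The square of coordinate i is the determinant of column i with `p`, so it vanishes only at the
  -- column representing `p`.
  let p : Fin 2 → F4 := ![x 1 ^ 2, x 0 ^ 2]
  have hp : p ≠ 0 := by
    intro h
    apply hx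
    have h1 := congrFun h 0
    have h2 := congrFun h 1
    ext i
    fin_cases i <;> simp_all [p]
  obtain ⟨j, hj⟩ := hbij.2 (Projectivization.mk F4 p hp)
  replace hj : Projectivization.mk F4 (M.col j) (h0 j) = Projectivization.mk F4 p hp := hj
  have hzero (i : Fin 5) : conjRowMap M x i = 0 ↔ i = j := by
    rw [← hbij.1.eq_iff, hj, projectivization_mk_eq_mk_iff_det, ← pow_eq_zero_iff two_ne_zero,
      conjRowMap_apply, CharTwo.add_sq, ← CharTwo.sub_eq_add]
    simp only [p, Matrix.col_apply, Matrix.cons_val_zero, Matrix.cons_val_one, mul_pow, ← pow_mul]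
    norm_num [F4.pow_four]
  simp only [hammingNorm, ne_eq, hzero]
  rw [Finset.filter_ne', Finset.card_erase_of_mem (Finset.mem_univ _)]
  rfl

variable {H : Submodule F4 (Fin 5 → F4)}

open Classical in
lemma IsHammingCode.hermitianDual_facts (hH : IsHammingCode 2 H) :
    (∀ w ∈ hermitianDual H, w ≠ 0 → hammingNorm w = 4) ∧
      Module.finrank F4 (hermitianDual H) = 2 := by
  obtain ⟨M, h0, hbij, rfl⟩ := hH
  rw [← hermitianDual_range_conjRowMap, hermitianDual_hermitianDual]
  have hnorm {x : Fin 2 → F4} (hx : x ≠ 0) := hammingNorm_conjRowMap h0 hbij hx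
  refine ⟨?_, ?_⟩
  · rintro _ ⟨x, rfl⟩ hne
    exact hnorm fun h => hne (by rw [h, map_zero])
  · rw [LinearMap.finrank_range_of_inj, Module.finrank_fin_fun]
    refine (injective_iff_map_eq_zero _).2 fun x hx => ?_
    by_contra hne
    have h := hnorm hne
    rw [hx, hammingNorm_zero] at h
    exact absurd h (by norm_num)

open Classical in
lemma IsHammingCode.hasMinDist (hH : IsHammingCode 2 H) :
    HasMinDist (H : Set (Fin 5 → F4)) 3 := by
  obtain ⟨M, h0, hbij, rfl⟩ := hH
  rw [hasMinDist_iff (Submodule.zero_mem _) fun x hx y hy => Submodule.sub_mem _ hx hy]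
  have hle : ∀ v ∈ LinearMap.ker M.mulVecLin, v ≠ 0 → 3 ≤ hammingNorm v := fun v hv hne =>
    three_le_hammingNorm_of_mulVec_eq_zero h0 hbij.1 (by simpa using hv) hne
  refine ⟨?_, ?_⟩
  · let u : Fin 5 → F4 := ![M 0 1 * M 1 2 - M 1 1 * M 0 2, M 0 2 * M 1 0 - M 1 2 * M 0 0,
      M 0 0 * M 1 1 - M 1 0 * M 0 1, 0, 0]
    have hmem : u ∈ LinearMap.ker M.mulVecLin := by
      rw [LinearMap.mem_ker, Matrix.mulVecLin_apply]
      ext r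
      fin_cases r <;> simp [u, Matrix.mulVec, dotProduct, Fin.sum_univ_five] <;> ring
    have hne : u ≠ 0 := by
      intro h
      have h2 : M 0 0 * M 1 1 - M 1 0 * M 0 1 = 0 := congrFun h 2
      have := hbij.1 ((projectivization_mk_eq_mk_iff_det (h0 0) (h0 1)).2 h2)
      exact absurd this (by decide)
    refine ⟨u, hmem, hne, le_antisymm ?_ (hle u hmem hne)⟩
    calc hammingNorm u ≤ ({0, 1, 2} : Finset (Fin 5)).card := by
          refine Finset.card_le_card fun i hi => ?_
          simp only [Finset.mem_filter, Finset.mem_univ, true_and] at hi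
          fin_cases i <;> simp_all [u]
      _ = 3 := rfl
  · rintro t ⟨v, hv, hne, rfl⟩
    exact hle v hv hne

lemma IsHammingCode.isLinearCode_hermitianDual (hH : IsHammingCode 2 H) :
    IsLinearCode (hermitianDual H) 5 2 4 := by
  obtain ⟨h1, h2⟩ := hH.hermitianDual_facts
  refine ⟨by simp, h2, ?_⟩
  rw [hasMinDist_iff (Submodule.zero_mem _) fun x hx y hy => Submodule.sub_mem _ hx hy]
  have hbot : hermitianDual H ≠ ⊥ := by
    intro h
    rw [h, finrank_bot] at h2
    exact absurd h2 (by norm_num)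
  obtain ⟨w, hw, hne⟩ := Submodule.exists_mem_ne_zero_of_ne_bot hbot
  refine ⟨⟨w, hw, hne, h1 w hw hne⟩, ?_⟩
  rintro t ⟨v, hv, hne, rfl⟩
  exact (h1 v hv hne).ge

lemma IsHammingCode.isLinearCode (hH : IsHammingCode 2 H) : IsLinearCode H 5 3 3 := by
  refine ⟨by simp, ?_, hH.hasMinDist⟩
  have h := finrank_add_finrank_hermitianDual H
  rw [hH.hermitianDual_facts.2, Fintype.card_fin] at h
  omega

lemma IsHammingCode.hermitianDual_le (hH : IsHammingCode 2 H) : hermitianDual H ≤ H := by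
  classical
  rw [← hermitianDual_hermitianDual H, hermitianDual_hermitianDual (hermitianDual H)]
  refine le_hermitianDual_of_even fun w hw => ?_
  by_cases h : w = 0
  · simp [h]
  · rw [hH.hermitianDual_facts.1 w hw h]
    decide

end HammingCodes

/-! ### The binary simplex code as the even-weight code -/

section SimplexCode

-- The three nonzero vectors of GF(2)² sum to zero and any two are independent, so the Hamming code
-- is the repetition code.
set_option maxRecDepth 10000 in
set_option synthInstance.maxSize 1000 in
set_option synthInstance.maxHeartbeats 200000 in
lemma kernel_of_distinct_nonzero_columns : ∀ a₀ a₁ b₀ b₁ c₀ c₁ : ZMod 2,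
    ¬(a₀ = 0 ∧ a₁ = 0) → ¬(b₀ = 0 ∧ b₁ = 0) → ¬(c₀ = 0 ∧ c₁ = 0) → ¬(a₀ = b₀ ∧ a₁ = b₁) →
    ¬(a₀ = c₀ ∧ a₁ = c₁) → ¬(b₀ = c₀ ∧ b₁ = c₁) → ∀ w₀ w₁ w₂ : ZMod 2,
    (a₀ * w₀ + b₀ * w₁ + c₀ * w₂ = 0 ∧ a₁ * w₀ + b₁ * w₁ + c₁ * w₂ = 0 ↔ w₁ = w₀ ∧ w₂ = w₀) := by
  decide

/-- The binary simplex code of dimension 2 consists of the words of even weight. -/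
lemma IsSimplexCode.mem_iff {S : Submodule (ZMod 2) (Fin 3 → ZMod 2)} (hS : IsSimplexCode 2 S)
    (v : Fin 3 → ZMod 2) : v ∈ S ↔ ∑ i, v i = 0 := by
  obtain ⟨_, ⟨M, h0, hbij, rfl⟩, rfl⟩ := hS
  have hne (i : Fin 3) : ¬(M 0 i = 0 ∧ M 1 i = 0) := fun h =>
    h0 i (by ext r; fin_cases r; exacts [h.1, h.2])
  have hdist {i j : Fin 3} (hij : i ≠ j) : ¬(M 0 i = M 0 j ∧ M 1 i = M 1 j) := by
    rintro ⟨h1, h2⟩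
    refine hij (hbij.1 ((projectivization_mk_eq_mk_iff_det (h0 i) (h0 j)).2 ?_))
    simp only [Matrix.col_apply, h1, h2]
    ring
  have hker (w : Fin 3 → ZMod 2) :
      w ∈ LinearMap.ker M.mulVecLin ↔ w 1 = w 0 ∧ w 2 = w 0 := by
    rw [← kernel_of_distinct_nonzero_columns _ _ _ _ _ _ (hne 0) (hne 1) (hne 2)
      (hdist (by decide)) (hdist (by decide)) (hdist (by decide)), LinearMap.mem_ker,
      Matrix.mulVecLin_apply, funext_iff, Fin.forall_fin_two]
    simp [Matrix.mulVec, dotProduct, Fin.sum_univ_three]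
  constructor
  · intro h
    simpa using h 1 ((hker 1).2 ⟨rfl, rfl⟩)
  · intro h w hw
    obtain ⟨h1, h2⟩ := (hker w).1 hw
    rw [Fin.sum_univ_three] at h ⊢
    rw [h1, h2]
    linear_combination w 0 * h

lemma IsSimplexCode.isLinearCode {S : Submodule (ZMod 2) (Fin 3 → ZMod 2)}
    (hS : IsSimplexCode 2 S) : IsLinearCode S 3 2 2 := by
  refine ⟨by simp, ?_, ?_⟩
  · have hcard : Nat.card S = 4 := by
      have e : S ≃ {v : Fin 3 → ZMod 2 // ∑ i, v i = 0} :=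
        Equiv.subtypeEquivRight hS.mem_iff
      rw [Nat.card_congr e, Nat.card_eq_fintype_card]
      decide
    rw [Module.natCard_eq_pow_finrank (K := ZMod 2), Nat.card_zmod] at hcard
    exact Nat.pow_right_injective le_rfl (hcard.trans (by norm_num : 4 = 2 ^ 2))
  · rw [hasMinDist_iff (Submodule.zero_mem _) fun x hx y hy => Submodule.sub_mem _ hx hy]
    have h : IsLeast {t | ∃ x : Fin 3 → ZMod 2, ∑ i, x i = 0 ∧ x ≠ 0 ∧ hammingNorm x = t} 2 := by
      refine ⟨⟨![1, 1, 0], by decide⟩, ?_⟩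
      rintro t ⟨x, h1, h2, rfl⟩
      revert x
      decide
    simp only [SetLike.mem_coe, hS.mem_iff]
    convert h
    rfl

end SimplexCode

/-! ### Product codes and their symplectic duals -/

section ProductCode

variable {ι κ : Type*}

lemma row_mem_of_mem_productCode {S : Submodule (ZMod 2) (ι → ZMod 2)}
    {A : Submodule (ZMod 2) (κ → F4)} {x : ι × κ → F4} (hx : x ∈ productCode S A) (i : ι) :
    (fun j => x (i, j)) ∈ A := by
  induction hx using Submodule.span_induction with
  | mem p hp =>
    obtain ⟨s, _, w, hw, rfl⟩ := hp
    exact A.smul_mem (s i) hw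
  | zero => exact A.zero_mem
  | add p q _ _ hp hq => exact A.add_mem hp hq
  | smul c p _ hp => exact A.smul_mem c hp

variable [Fintype ι]

lemma sum_rows_of_mem_productCode {S : Submodule (ZMod 2) (ι → ZMod 2)}
    (hS : ∀ s ∈ S, ∑ i, s i = 0) {A : Submodule (ZMod 2) (κ → F4)} {x : ι × κ → F4}
    (hx : x ∈ productCode S A) (j : κ) : ∑ i, x (i, j) = 0 := by
  induction hx using Submodule.span_induction with
  | mem p hp =>
    obtain ⟨s, hs, w, _, rfl⟩ := hp
    simp only [← Finset.sum_smul, hS s hs, zero_smul]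
  | zero => simp
  | add p q _ _ hp hq => simp only [Pi.add_apply, Finset.sum_add_distrib, hp, hq, add_zero]
  | smul c p _ hp => simp only [Pi.smul_apply, ← Finset.smul_sum, hp, smul_zero]

variable [Fintype κ]

open Classical in
lemma hammingNorm_prod {α : Type*} [Zero α] (x : ι × κ → α) :
    hammingNorm x = ∑ i, hammingNorm fun j => x (i, j) := by
  simp only [hammingNorm, Finset.card_filter, Fintype.sum_prod_type]

/-- The product of x with s ⊗ w equals that of the row combination ∑ s_i x_i with w. -/
lemma mem_symplecticDual_productCode {S : Submodule (ZMod 2) (ι → ZMod 2)}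
    {A : Submodule (ZMod 2) (κ → F4)} {x : ι × κ → F4} :
    x ∈ symplecticDual (productCode S A) ↔
      ∀ s ∈ S, ∑ i, s i • (fun j => x (i, j)) ∈ symplecticDual A := by
  have key (s : ι → ZMod 2) (w : κ → F4) :
      symplecticForm (ι × κ) x (fun ij => s ij.1 • w ij.2) =
        symplecticForm κ (∑ i, s i • (fun j => x (i, j))) w := by
    have h (i : ι) : s i * ∑ j, Algebra.trace (ZMod 2) F4 (x (i, j) * w j ^ 2) =
        ∑ j, Algebra.trace (ZMod 2) F4 (x (i, j) * (s i • w j) ^ 2) := by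
      rcases eq_zero_or_one_of_zmod_two (s i) with h | h <;> simp [h]
    rw [map_sum, LinearMap.sum_apply, symplecticForm_apply, Fintype.sum_prod_type]
    refine Finset.sum_congr rfl fun i _ => ?_
    rw [map_smul, LinearMap.smul_apply, symplecticForm_apply, smul_eq_mul, h]
  constructor
  · intro h s hs w hw
    have := h _ (Submodule.subset_span ⟨s, hs, w, hw, rfl⟩)
    exact (key s w).symm.trans this
  · intro h p hp
    change symplecticForm (ι × κ) x p = 0
    induction hp using Submodule.span_induction with
    | mem p hp =>
      obtain ⟨s, hs, w, hw, rfl⟩ := hp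
      exact (key s w).trans (h s hs w hw)
    | zero => simp
    | add p q _ _ hp hq => rw [map_add, hp, hq, add_zero]
    | smul c p _ hp => rw [map_smul, hp, smul_zero]

/-- The product of a binary code with a self-orthogonal code is self-orthogonal. -/
lemma productCode_le_symplecticDual (S : Submodule (ZMod 2) (ι → ZMod 2))
    {A : Submodule (ZMod 2) (κ → F4)} (hA : A ≤ symplecticDual A) :
    productCode S A ≤ symplecticDual (productCode S A) := fun _ hx =>
  mem_symplecticDual_productCode.2 fun s _ =>
    Submodule.sum_mem _ fun i _ => Submodule.smul_mem _ (s i) (hA (row_mem_of_mem_productCode hx i))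

variable {S : Submodule (ZMod 2) (Fin 3 → ZMod 2)} (hS : ∀ v, v ∈ S ↔ ∑ i, v i = 0)
  {A : Submodule (ZMod 2) (κ → F4)}

include hS

/-- The words 101 and 011 span the even code; they are paired with rows 0 and 1, and row 2 is the
sum of these. -/
lemma mem_productCode_evenCode {x : Fin 3 × κ → F4} :
    x ∈ productCode S A ↔ (∀ i, (fun j => x (i, j)) ∈ A) ∧ ∀ j, ∑ i, x (i, j) = 0 := by
  refine ⟨fun h => ⟨row_mem_of_mem_productCode h,
    sum_rows_of_mem_productCode (fun s hs => (hS s).1 hs) h⟩, fun ⟨h1, h2⟩ => ?_⟩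
  have e : x = (fun ij => (![1, 0, 1] : Fin 3 → ZMod 2) ij.1 • x (0, ij.2)) +
      fun ij => (![0, 1, 1] : Fin 3 → ZMod 2) ij.1 • x (1, ij.2) := by
    ext ⟨i, j⟩
    have h := h2 j
    rw [Fin.sum_univ_three] at h
    fin_cases i
    · simp
    · simp
    · simp only [Fin.reduceFinMk, Pi.add_apply, Matrix.cons_val, one_smul]
      exact (CharTwo.add_eq_zero.1 h).symm
  rw [e]
  exact Submodule.add_mem _
    (Submodule.subset_span ⟨_, (hS _).2 (by decide), fun j => x (0, j), h1 0, rfl⟩)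
    (Submodule.subset_span ⟨_, (hS _).2 (by decide), fun j => x (1, j), h1 1, rfl⟩)

lemma natCard_productCode_evenCode : Nat.card (productCode S A) = Nat.card A * Nat.card A := by
  rw [← Nat.card_prod]
  let f : productCode S A → A × A := fun x =>
    (⟨fun j => x.1 (0, j), row_mem_of_mem_productCode x.2 0⟩,
      ⟨fun j => x.1 (1, j), row_mem_of_mem_productCode x.2 1⟩)
  refine Nat.card_congr (Equiv.ofBijective f ⟨?_, ?_⟩)
  · intro x y hxy
    simp only [f, Prod.mk.injEq, Subtype.mk.injEq] at hxy
    ext ⟨i, j⟩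
    have h0 := congrFun hxy.1 j
    have h1 := congrFun hxy.2 j
    have hx := ((mem_productCode_evenCode hS).1 x.2).2 j
    have hy := ((mem_productCode_evenCode hS).1 y.2).2 j
    rw [Fin.sum_univ_three] at hx hy
    fin_cases i
    · exact h0
    · exact h1
    · simp only [Fin.reduceFinMk]
      linear_combination hx - hy - h0 - h1
  · rintro ⟨u, v⟩
    let x : Fin 3 × κ → F4 := fun ij => ![u.1, v.1, u.1 + v.1] ij.1 ij.2
    have hx : x ∈ productCode S A := by
      refine (mem_productCode_evenCode hS).2 ⟨fun i => ?_, fun j => ?_⟩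
      · fin_cases i
        exacts [u.2, v.2, A.add_mem u.2 v.2]
      · rw [Fin.sum_univ_three]
        exact CharTwo.add_self_eq_zero (u.1 j + v.1 j)
    exact ⟨⟨x, hx⟩, rfl⟩

-- Rows summing to zero cannot have exactly one nonzero member, so at least two rows have weight at
-- least d.
open Classical in
lemma two_mul_le_hammingNorm_of_mem_productCode {d : ℕ}
    (hd : ∀ w ∈ A, w ≠ 0 → d ≤ hammingNorm w) {x : Fin 3 × κ → F4} (hx : x ∈ productCode S A)
    (hne : x ≠ 0) : 2 * d ≤ hammingNorm x := by
  obtain ⟨h1, h2⟩ := (mem_productCode_evenCode hS).1 hx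
  have hnorm (i : Fin 3) : (fun j => x (i, j)) = 0 ∨ d ≤ hammingNorm fun j => x (i, j) :=
    or_iff_not_imp_left.2 (hd _ (h1 i))
  have hrow (i k l : Fin 3) (hikl : ∀ j, x (i, j) + x (k, j) + x (l, j) = 0)
      (hk : (fun j => x (k, j)) = 0) (hl : (fun j => x (l, j)) = 0) : (fun j => x (i, j)) = 0 := by
    funext j
    simpa [congrFun hk j, congrFun hl j] using hikl j
  have h012 (j : κ) : x (0, j) + x (1, j) + x (2, j) = 0 := by rw [← h2 j, Fin.sum_univ_three]
  have e0 := hrow 0 1 2 h012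
  have e1 := hrow 1 0 2 fun j => by rw [← h012 j]; ring
  have e2 := hrow 2 0 1 fun j => by rw [← h012 j]; ring
  have hall : ¬((fun j => x (0, j)) = 0 ∧ (fun j => x (1, j)) = 0 ∧ (fun j => x (2, j)) = 0) := by
    rintro ⟨z0, z1, z2⟩
    refine hne (funext fun ⟨i, j⟩ => ?_)
    fin_cases i
    exacts [congrFun z0 j, congrFun z1 j, congrFun z2 j]
  rw [hammingNorm_prod, Fin.sum_univ_three]
  rcases hnorm 0 with z0 | n0 <;> rcases hnorm 1 with z1 | n1 <;> rcases hnorm 2 with z2 | n2 <;>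
    first | omega | exact absurd ⟨by tauto, by tauto, by tauto⟩ hall

lemma hasMinDist_productCode_evenCode {d : ℕ} (hd : HasMinDist (A : Set (κ → F4)) d) :
    HasMinDist (productCode S A : Set (Fin 3 × κ → F4)) (2 * d) := by
  classical
  rw [hasMinDist_iff (Submodule.zero_mem _) fun x hx y hy => Submodule.sub_mem _ hx hy] at hd ⊢
  obtain ⟨⟨w, hw, hne, rfl⟩, hmin⟩ := hd
  constructor
  · refine ⟨fun ij => (![1, 1, 0] : Fin 3 → ZMod 2) ij.1 • w ij.2,
      Submodule.subset_span ⟨_, (hS _).2 (by decide), w, hw, rfl⟩, fun h => hne ?_, ?_⟩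
    · funext j
      simpa using congrFun h (0, j)
    · rw [hammingNorm_prod, Fin.sum_univ_three, two_mul]
      simp [hammingNorm]
  · rintro t ⟨x, hx, hxne, rfl⟩
    exact two_mul_le_hammingNorm_of_mem_productCode hS (fun w hw hne => hmin ⟨w, hw, hne, rfl⟩)
      hx hxne

open Classical in
lemma three_le_hammingNorm_of_mem_symplecticDual
    (hd : ∀ w ∈ symplecticDual A, w ≠ 0 → 3 ≤ hammingNorm w) {x : Fin 3 × κ → F4}
    (hx : x ∈ symplecticDual (productCode S A)) (hne : x ≠ 0) : 3 ≤ hammingNorm x := by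
  by_contra! hlt
  rw [mem_symplecticDual_productCode] at hx
  have hn := hammingNorm_prod x
  rw [Fin.sum_univ_three] at hn
  have hle (u v : κ → F4) : hammingNorm (u + v) ≤ hammingNorm u + hammingNorm v := by
    refine (Finset.card_le_card fun j hj => ?_).trans (Finset.card_union_le _ _)
    simp only [Finset.mem_union, Finset.mem_filter, Finset.mem_univ, true_and] at hj ⊢
    by_contra! h
    simp [h.1, h.2] at hj
  have heq (u v : κ → F4) (hmem : u + v ∈ symplecticDual A)
      (hlt : hammingNorm u + hammingNorm v < 3) : u = v := by
    by_contra h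
    have h0 : u + v ≠ 0 := fun h0 => h (funext fun j => CharTwo.add_eq_zero.1 (congrFun h0 j))
    have := hd _ hmem h0
    have := hle u v
    omega
  -- The even words 110 and 101 put these sums of two rows into the dual of `A`, where weight below
  -- 3 forces zero.
  have h01 : (fun j => x (0, j)) = fun j => x (1, j) := by
    refine heq _ _ ?_ (by omega)
    simpa [Fin.sum_univ_three] using hx ![1, 1, 0] ((hS _).2 (by decide))
  have h02 : (fun j => x (0, j)) = fun j => x (2, j) := by
    refine heq _ _ ?_ (by omega)
    simpa [Fin.sum_univ_three] using hx ![1, 0, 1] ((hS _).2 (by decide))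
  rw [← h01, ← h02] at hn
  have hz : hammingNorm (fun j => x (0, j)) = 0 := by omega
  rw [hz] at hn
  exact hne (hammingNorm_eq_zero.1 hn)

lemma hasMinDist_symplecticDual_productCode [Nonempty κ]
    (hd : HasMinDist (symplecticDual A : Set (κ → F4)) 3) :
    HasMinDist (symplecticDual (productCode S A) : Set (Fin 3 × κ → F4)) 3 := by
  classical
  rw [hasMinDist_iff (Submodule.zero_mem _) fun x hx y hy => Submodule.sub_mem _ hx hy] at hd ⊢
  constructor
  · obtain ⟨k⟩ := ‹Nonempty κ›
    -- Three equal rows of weight 1: every combination by an even word s is zero, whatever `A` is.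
    refine ⟨fun ij => (Pi.single k 1 : κ → F4) ij.2, ?_, fun h => ?_, ?_⟩
    · refine mem_symplecticDual_productCode.2 fun s hs => ?_
      change ∑ i, s i • (Pi.single k 1 : κ → F4) ∈ symplecticDual A
      rw [← Finset.sum_smul, (hS s).1 hs, zero_smul]
      exact Submodule.zero_mem _
    · simpa using congrFun h (0, k)
    · rw [hammingNorm_prod]
      have h1 : hammingNorm (Pi.single k 1 : κ → F4) = 1 :=
        Finset.card_eq_one.2 ⟨k, by ext; simp [Pi.single_apply]⟩
      simp [h1]
  · rintro t ⟨x, hx, hne, rfl⟩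
    exact three_le_hammingNorm_of_mem_symplecticDual hS
      (fun w hw hne => hd.2 ⟨w, hw, hne, rfl⟩) hx hne

end ProductCode

/-! ### Quantum parameters, rates and the main theorem -/

open Classical in
/-- If the minimum distance of `D` exceeds that of its symplectic dual, then the latter is the
least weight of a word of the dual outside of `D`. -/
lemma isLeast_hammingNorm_symplecticDual_diff {ι : Type*} [Fintype ι]
    {D : Submodule (ZMod 2) (ι → F4)} {d d' : ℕ} (hD : HasMinDist (D : Set (ι → F4)) d')
    (hdual : HasMinDist (symplecticDual D : Set (ι → F4)) d) (hlt : d < d') :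
    IsLeast {t | ∃ e ∈ symplecticDual D, e ∉ D ∧ hammingNorm e = t} d := by
  rw [hasMinDist_iff (Submodule.zero_mem _) fun x hx y hy => Submodule.sub_mem _ hx hy] at hD hdual
  obtain ⟨⟨e, he, hne, rfl⟩, hmin⟩ := hdual
  refine ⟨⟨e, he, fun heD => ?_, rfl⟩, ?_⟩
  · have := hD.2 ⟨e, heD, hne, rfl⟩
    omega
  · rintro t ⟨x, hx, hxD, rfl⟩
    exact hmin ⟨x, hx, fun h => hxD (h ▸ D.zero_mem), rfl⟩

lemma IsQECC.quantumRate_eq {ι : Type*} [Fintype ι] [DecidableEq ι]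
    {Q : Submodule ℂ (QState ι)} {n k d : ℕ} (h : IsQECC Q n k d) : quantumRate Q = k / n := by
  rw [quantumRate, h.2.1, h.1]
  push_cast
  rw [Real.logb_pow, Real.logb_self_eq_one (by norm_num), mul_one]

theorem mainTheorem6 :
    (∃ H : Submodule F4 (Fin 5 → F4), IsHammingCode 2 H) ∧
    (∃ S : Submodule (ZMod 2) (Fin 3 → ZMod 2), IsSimplexCode 2 S) ∧
    ∀ (H : Submodule F4 (Fin 5 → F4)) (_ : IsHammingCode 2 H)
      (S : Submodule (ZMod 2) (Fin 3 → ZMod 2)) (_ : IsSimplexCode 2 S)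
      (C : Submodule F4 (Fin 5 → F4)) (_ : C = hermitianDual H)
      (A : Submodule (ZMod 2) (Fin 5 → F4)) (_ : A = C.restrictScalars (ZMod 2))
      (P : Submodule (ZMod 2) (Fin 3 × Fin 5 → F4)) (_ : P = productCode S A),
      -- the factors
      IsLinearCode C 5 2 4 ∧ C ≤ hermitianDual C ∧ IsLinearCode (hermitianDual C) 5 3 3 ∧
      IsLinearCode S 3 2 2 ∧
      -- the product code and its symplectic dual
      IsAdditiveCode P 15 (2 ^ 8) 8 ∧ P ≤ symplecticDual P ∧
      IsAdditiveCode (symplecticDual P) 15 (2 ^ 22) 3 ∧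
      -- the quantum codes
      ∀ ω : F4, ω ^ 2 + ω + 1 = 0 →
        (∃ Q : Submodule ℂ (QState (Fin 5)), IsStabilizerCodeOf ω A Q) ∧
        (∀ Q : Submodule ℂ (QState (Fin 5)), IsStabilizerCodeOf ω A Q → IsQECC Q 5 1 3) ∧
        (∃ Q : Submodule ℂ (QState (Fin 3 × Fin 5)), IsStabilizerCodeOf ω P Q) ∧
        (∀ Q : Submodule ℂ (QState (Fin 3 × Fin 5)), IsStabilizerCodeOf ω P Q →
          IsQECC Q 15 7 3) ∧
        (∀ (Q₀ : Submodule ℂ (QState (Fin 5))) (Q : Submodule ℂ (QState (Fin 3 × Fin 5))),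
          IsStabilizerCodeOf ω A Q₀ → IsStabilizerCodeOf ω P Q →
          quantumRate Q₀ = 1 / 5 ∧ quantumRate Q = 7 / 15 ∧
            quantumRate Q₀ < quantumRate Q) := by
  refine ⟨exists_isHammingCode_two (by rw [natCard_F4]),
    exists_isHammingCode_two (F := ZMod 2) (n := 3) (by simp) |>.imp' euclideanDual
      fun H hH => ⟨H, hH, rfl⟩, ?_⟩
  rintro H hH S hS C rfl A rfl P rfl
  have hC := hH.isLinearCode_hermitianDual
  have hAdual : symplecticDual ((hermitianDual H).restrictScalars (ZMod 2)) =
      H.restrictScalars (ZMod 2) := by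
    rw [← restrictScalars_hermitianDual, hermitianDual_hermitianDual]
  have hAle : (hermitianDual H).restrictScalars (ZMod 2) ≤
      symplecticDual ((hermitianDual H).restrictScalars (ZMod 2)) := by
    rw [hAdual]
    exact hH.hermitianDual_le
  have hAcard : Nat.card ((hermitianDual H).restrictScalars (ZMod 2)) = 2 ^ 4 := by
    have h := natCard_eq_four_pow_finrank (hermitianDual H)
    rw [hC.2.1] at h
    exact h
  have hAdist : HasMinDist
      (symplecticDual ((hermitianDual H).restrictScalars (ZMod 2)) : Set (Fin 5 → F4)) 3 := by
    rw [hAdual]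
    exact hH.hasMinDist
  -- From here only the size, self-orthogonality and two minimum distances of the additive code
  -- matter.
  generalize hA : (hermitianDual H).restrictScalars (ZMod 2) = A at *
  have hAmin : HasMinDist (A : Set (Fin 5 → F4)) 4 := by
    rw [← hA]
    exact hC.2.2
  have hPcard : Nat.card (productCode S A) = 2 ^ 8 := by
    rw [natCard_productCode_evenCode hS.mem_iff, hAcard]
    norm_num
  have hPmin := hasMinDist_productCode_evenCode hS.mem_iff hAmin
  have hPle := productCode_le_symplecticDual S hAle
  have hPdist := hasMinDist_symplecticDual_productCode hS.mem_iff hAdist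
  have hPdual : Nat.card (symplecticDual (productCode S A)) = 2 ^ 22 := by
    have h := natCard_mul_natCard_symplecticDual (productCode S A)
    rw [hPcard, Fintype.card_prod, Fintype.card_fin, Fintype.card_fin] at h
    exact Nat.eq_of_mul_eq_mul_left (by norm_num : 0 < 2 ^ 8) (h.trans (by norm_num))
  refine ⟨hC, ?_, ?_, hS.isLinearCode, ⟨by simp, hPcard, hPmin⟩, hPle, ⟨by simp, hPdual, hPdist⟩,
    fun ω hω => ?_⟩
  · rw [hermitianDual_hermitianDual]
    exact hH.hermitianDual_le
  · rw [hermitianDual_hermitianDual]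
    exact hH.isLinearCode
  have hQA (Q : Submodule ℂ (QState (Fin 5))) (hQ : IsStabilizerCodeOf ω A Q) : IsQECC Q 5 1 3 :=
    hQ.isQECC hω (by simp) hAcard rfl
      (isLeast_hammingNorm_symplecticDual_diff hAmin hAdist (by norm_num))
  have hQP (Q : Submodule ℂ (QState (Fin 3 × Fin 5)))
      (hQ : IsStabilizerCodeOf ω (productCode S A) Q) : IsQECC Q 15 7 3 :=
    hQ.isQECC hω (by simp) hPcard rfl
      (isLeast_hammingNorm_symplecticDual_diff hPmin hPdist (by norm_num))
  refine ⟨exists_isStabilizerCodeOf hω hAle, hQA, exists_isStabilizerCodeOf hω hPle, hQP,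
    fun Q₀ Q h₀ h => ?_⟩
  rw [(hQA Q₀ h₀).quantumRate_eq, (hQP Q h).quantumRate_eq]
  norm_num
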